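/- C*-algebras are not assumed unital, and $*$-homomorphisms need not preserve units. Let $G=\{g_1,\dots,g_n\}$ be a finite set of generators and $R$ a finite set of relations $\|t(g_1,\dots,g_n)\|\le c$ with $c\ge 0$, where $t$ is built from the generators by the $*$-algebra operations (so $*$-polynomials without constant term are allowed) and by continuous functional calculus with continuous functions $f:\mathbb R\to\mathbb R$, $f(0)=0$, applied to real parts $\frac12(x+x^*)$; thus norm conditions, $*$-polynomial equations and equations $f(x)=y$ with $x$ self-adjoint are included. For $\varepsilon\ge 0$ let $C^*_\varepsilon\langle G,R\rangle$, if it exists, be the universal C*-algebra generated by $g^\varepsilon_1,\dots,g^\varepsilon_n$ subject to the relations $\|t(g^\varepsilon_1,\dots,g^\varepsilon_n)\|\le c+\varepsilon$, and let $C^*\langle G,R\rangle=C^*_0\langle G,R\rangle$. A C*-algebra $A$ is finitely presented with stable relations if $A\cong C^*\langle G,R\rangle$ for some such finite $G$ and $R$ such that for every $\delta>0$ there are $\varepsilon>0$, for which $C^*_\varepsilon\langle G,R\rangle$ exists, and a $*$-homomorphism $\sigma_\varepsilon:C^*\langle G,R\rangle\to C^*_\varepsilon\langle G,R\rangle$ with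 $\|\sigma_\varepsilon(g_j)-g^\varepsilon_j\|\le\delta$ for all $j$. Theorem ($C'=C''$). Let $C$ be the class of finitely presented C*-algebras with stable relations. Let $C'$ be the class of all inductive limits of sequences $A_0\to A_1\to A_2\to\cdots$ of algebras from $C$ (with arbitrary $*$-homomorphisms, not necessarily injective, as connecting maps), and let $C''$ be the smallest class of C*-algebras that contains $C$ and is closed under taking inductive limits of sequences. Then $C'=C''$. -/

import Mathlib

open Filter Topology
open scoped NNReal

universe u v

/-! ### Generators and relations -/

/-- Formal expressions in `n` noncommuting variables: everything that can be built from the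
variables by the `*`-algebra operations (that is, `*`-polynomials without constant term) and by
continuous functional calculus with continuous functions `f : ℝ → ℝ`, `f 0 = 0`. -/
inductive CStarExpr (n : ℕ) : Type
  | gen (i : Fin n) : CStarExpr n
  | add (s t : CStarExpr n) : CStarExpr n
  | smul (c : ℂ) (t : CStarExpr n) : CStarExpr n
  | mul (s t : CStarExpr n) : CStarExpr n
  | star (t : CStarExpr n) : CStarExpr n
  | fc (f : ContinuousMapZero ℝ ℝ) (t : CStarExpr n) : CStarExpr n

/-- The value of an expression at a tuple of elements of a C*-algebra. A function is applied to the
real part `(x + x*)/2` of the value `x` of its argument. This is `f(x)` whenever `x` is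
self-adjoint, and it remains meaningful when `x` is self-adjoint only up to some error. -/
noncomputable def CStarExpr.eval {n : ℕ} {B : Type v} [NonUnitalCStarAlgebra B]
    (b : Fin n → B) : CStarExpr n → B
  | .gen i => b i
  | .add s t => s.eval b + t.eval b
  | .smul c t => c • t.eval b
  | .mul s t => s.eval b * t.eval b
  | .star t => Star.star (t.eval b)
  | .fc f t => cfcₙ (fun x : ℝ => f x) (realPart (t.eval b) : B)

/-- A relation `‖t‖ ≤ c` on `n` generators, with `c ≥ 0`. For `c = 0` this is the relation `t = 0`;
so norm conditions, `*`-polynomial equations and relations such as `f(x) = y` are of this form. -/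
structure CStarRel (n : ℕ) : Type where
  /-- the expression `t` -/
  expr : CStarExpr n
  /-- the bound `c` -/
  bound : ℝ≥0

/-- The tuple `b` in the C*-algebra `B` satisfies the relations `R` up to `ε`, that is,
`‖t(b)‖ ≤ c + ε` for all relations `‖t‖ ≤ c` in `R`. For `ε = 0`: exactly. -/
def IsRepUpTo {n : ℕ} (R : Set (CStarRel n)) (ε : ℝ) {B : Type v} [NonUnitalCStarAlgebra B]
    (b : Fin n → B) : Prop :=
  ∀ r ∈ R, ‖r.expr.eval b‖ ≤ (r.bound : ℝ) + ε

/-- `A`, with the tuple of generators `g`, is the universal C*-algebra `C*_ε⟨G | R⟩` for the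
relations `R` up to `ε`; for `ε = 0` it is `C*⟨G | R⟩`. Algebras need not be unital, and
homomorphisms need not preserve a unit. -/
def IsUniversalFor {n : ℕ} (R : Set (CStarRel n)) (ε : ℝ) (A : Type u) [NonUnitalCStarAlgebra A]
    (g : Fin n → A) : Prop :=
  IsRepUpTo R ε g ∧
    ∀ (B : Type u) [NonUnitalCStarAlgebra B] (b : Fin n → B), IsRepUpTo R ε b →
      ∃! π : A →⋆ₙₐ[ℂ] B, ∀ i, π (g i) = b i

/-- The presentation `A = C*⟨G | R⟩`, with generators `g`, is (weakly) stable: for every `δ > 0`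
there are `ε > 0` and a `*`-homomorphism `σ : C*⟨G | R⟩ → C*_ε⟨G | R⟩` that moves the generators
by at most `δ`. (The canonical map `C*_ε⟨G | R⟩ → C*⟨G | R⟩` takes the generator `e i` to `g i`,
so `σ (g i)` is the image of `e i` under the composite of the two maps.) -/
def IsWeaklyStable {n : ℕ} (R : Set (CStarRel n)) (A : Type u) [NonUnitalCStarAlgebra A]
    (g : Fin n → A) : Prop :=
  ∀ δ : ℝ, 0 < δ → ∃ ε : ℝ, 0 < ε ∧
    ∃ (E : Type u) (_ : NonUnitalCStarAlgebra E) (e : Fin n → E), IsUniversalFor R ε E e ∧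
      ∃ σ : A →⋆ₙₐ[ℂ] E, ∀ i, ‖σ (g i) - e i‖ ≤ δ

/-! ### Classes of C*-algebras and sequential inductive limits -/

/-- A class of (not necessarily unital) C*-algebras. -/
abbrev CStarClass : Type (u + 1) :=
  ∀ (A : Type u) [NonUnitalCStarAlgebra A], Prop

/-- The class of C*-algebras that have a finite presentation with stable relations. -/
def HasStablePresentation : CStarClass.{u} := fun A _ =>
  ∃ (n : ℕ) (R : Set (CStarRel n)) (g : Fin n → A),
    R.Finite ∧ IsUniversalFor R 0 A g ∧ IsWeaklyStable R A g

/-- The composite `A n → A (n + 1) → ⋯ → A (n + k)` of the connecting maps of a sequence. -/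
def connectingMap {A : ℕ → Type u} [∀ n, NonUnitalCStarAlgebra (A n)]
    (φ : ∀ n, A n →⋆ₙₐ[ℂ] A (n + 1)) (n : ℕ) : ∀ k : ℕ, A n →⋆ₙₐ[ℂ] A (n + k)
  | 0 => NonUnitalStarAlgHom.id ℂ (A n)
  | k + 1 => (φ (n + k)).comp (connectingMap φ n k)

/-- `B`, with the maps `ψ n : A n → B`, is the inductive limit of the sequence
`A 0 → A 1 → A 2 → ⋯` of C*-algebras: the completion of the algebraic direct limit (modulo null
vectors) in the C*-seminorm given by `x ↦ lim_k ‖φ_{n, n+k} x‖` on the image of `A n`. The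
connecting maps need not be injective. -/
structure IsInductiveLimit {A : ℕ → Type u} [∀ n, NonUnitalCStarAlgebra (A n)]
    (φ : ∀ n, A n →⋆ₙₐ[ℂ] A (n + 1)) (B : Type u) [NonUnitalCStarAlgebra B]
    (ψ : ∀ n, A n →⋆ₙₐ[ℂ] B) : Prop where
  compatible : ∀ n x, ψ (n + 1) (φ n x) = ψ n x
  dense : Dense (⋃ n, Set.range (ψ n))
  norm_eq : ∀ n x, Tendsto (fun k => ‖connectingMap φ n k x‖) atTop (𝓝 ‖ψ n x‖)

/-- The class of all inductive limits of sequences of algebras from `𝒞`. -/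
def SequentialLimits (𝒞 : CStarClass.{u}) : CStarClass.{u} := fun B _ =>
  ∃ (A : ℕ → Type u) (_ : ∀ n, NonUnitalCStarAlgebra (A n))
    (φ : ∀ n, A n →⋆ₙₐ[ℂ] A (n + 1)) (ψ : ∀ n, A n →⋆ₙₐ[ℂ] B),
    (∀ n, 𝒞 (A n)) ∧ IsInductiveLimit φ B ψ

/-- The smallest class of C*-algebras that contains `𝒞` and is closed under taking inductive limits
of sequences. -/
def LimitClosure (𝒞 : CStarClass.{u}) : CStarClass.{u} := fun B _ =>
  ∀ 𝒟 : CStarClass.{u},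
    (∀ (A : Type u) [NonUnitalCStarAlgebra A], 𝒞 A → 𝒟 A) →
    (∀ (A : Type u) [NonUnitalCStarAlgebra A], SequentialLimits 𝒟 A → 𝒟 A) →
    𝒟 B

/-! The inclusion of `C'` in `C''` is formal. For the converse, stability acts as approximate
projectivity. Given `θ : C → lim A n` with `C` in the class, generators lifted to a finite stage
satisfy the relations up to `ε` further along, since limit norms are limits of norms; composing `σ`
with the map from `C*_ε` gives an approximate lift of `θ`
(`HasStablePresentation.exists_approximate_lift`).

Hence approximate factorization through the class passes to sequential limits, so it holds on all of
`C''`, as does separability. Iterating factorizations over growing finite sets builds a sequence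
from the class whose maps to `B` commute up to summable errors, and an approximate intertwining
makes `B` its limit. As connecting maps may have kernels, factorizations must also control norms:
`‖α x‖ ≤ ‖θ x‖ + ε` makes the limit seminorm agree with the norm of `B`. -/

theorem norm_map_sub_map_le {A : Type*} {B : Type*} [NonUnitalCStarAlgebra A]
    [NonUnitalCStarAlgebra B] (π : A →⋆ₙₐ[ℂ] B) (x y : A) : ‖π x - π y‖ ≤ ‖x - y‖ := by
  simpa using NonUnitalStarAlgHom.norm_apply_le π (x - y)

theorem lipschitzWith_nonUnitalStarAlgHom {A : Type*} {B : Type*} [NonUnitalCStarAlgebra A]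
    [NonUnitalCStarAlgebra B] (π : A →⋆ₙₐ[ℂ] B) : LipschitzWith 1 π :=
  LipschitzWith.of_dist_le_mul fun x y => by
    simpa [dist_eq_norm] using norm_map_sub_map_le π x y

theorem continuous_nonUnitalStarAlgHom {A : Type*} {B : Type*} [NonUnitalCStarAlgebra A]
    [NonUnitalCStarAlgebra B] (π : A →⋆ₙₐ[ℂ] B) : Continuous π :=
  (lipschitzWith_nonUnitalStarAlgHom π).continuous

theorem equicontinuous_nonUnitalStarAlgHom {ι : Type*} {A : Type*} {B : Type*}
    [NonUnitalCStarAlgebra A] [NonUnitalCStarAlgebra B] (F : ι → A →⋆ₙₐ[ℂ] B) :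
    Equicontinuous fun i x => F i x :=
  (LipschitzWith.uniformEquicontinuous _ 1 fun i =>
    lipschitzWith_nonUnitalStarAlgHom (F i)).equicontinuous

/-! ### Evaluation of expressions: naturality and continuity -/

namespace CStarExpr

theorem map_eval {n : ℕ} {A : Type*} {B : Type*} [NonUnitalCStarAlgebra A]
    [NonUnitalCStarAlgebra B] (π : A →⋆ₙₐ[ℂ] B) (a : Fin n → A) (t : CStarExpr n) :
    π (t.eval a) = t.eval fun i => π (a i) := by
  induction t with
  | gen i => rfl
  | add s t hs ht => simp [eval, hs, ht]
  | smul c t ht => simp [eval, ht]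
  | mul s t hs ht => simp [eval, hs, ht]
  | star t ht => simp [eval, map_star, ht]
  | fc f t ht =>
    rw [eval, eval, ← ht, ← map_realPart]
    exact NonUnitalStarAlgHom.map_cfcₙ π _ _ (map_continuous f).continuousOn (map_zero f)
      (continuous_nonUnitalStarAlgHom π) (realPart _).2 (by rw [map_realPart]; exact (realPart _).2)

/-- Real parts are always self-adjoint, so the functional calculus is continuous on all tuples, not
only on exact representations. -/
theorem continuous_eval {n : ℕ} {B : Type*} [NonUnitalCStarAlgebra B] (t : CStarExpr n) :
    Continuous fun b : Fin n → B => t.eval b := by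
  induction t with
  | gen i => exact continuous_apply i
  | add s t hs ht => exact hs.add ht
  | smul c t ht => exact ht.const_smul c
  | mul s t hs ht => exact hs.mul ht
  | star t ht => exact ht.star
  | fc f t ht =>
    refine Continuous.cfcₙ_of_mem_nhdsSet (s := Set.univ) (fun x : ℝ => f x) Filter.univ_mem ?_
      (fun b => (realPart _).2) (map_continuous f).continuousOn (map_zero f)
    simp only [realPart_apply_coe]
    exact (ht.add ht.star).const_smul _

end CStarExpr

/-! ### Universal algebras are determined by their generators -/

theorem isRepUpTo_map_iff_of_injective {n : ℕ} {R : Set (CStarRel n)} {ε : ℝ} {A : Type*}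
    {B : Type*} [NonUnitalCStarAlgebra A] [NonUnitalCStarAlgebra B] (π : A →⋆ₙₐ[ℂ] B)
    (hπ : Function.Injective π) (a : Fin n → A) :
    IsRepUpTo R ε (fun i => π (a i)) ↔ IsRepUpTo R ε a := by
  simp only [IsRepUpTo, ← CStarExpr.map_eval, NonUnitalStarAlgHom.norm_map π hπ]

theorem IsRepUpTo.map {n : ℕ} {R : Set (CStarRel n)} {ε : ℝ} {A : Type*} {B : Type*}
    [NonUnitalCStarAlgebra A] [NonUnitalCStarAlgebra B] {a : Fin n → A} (ha : IsRepUpTo R ε a)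
    (π : A →⋆ₙₐ[ℂ] B) : IsRepUpTo R ε fun i => π (a i) := fun r hr => by
  rw [← CStarExpr.map_eval]
  exact (NonUnitalStarAlgHom.norm_apply_le π _).trans (ha r hr)

/-- A closed `*`-subalgebra that contains the generators of a universal C*-algebra is everything. -/
theorem IsUniversalFor.mem_of_isClosed {n : ℕ} {R : Set (CStarRel n)} {ε : ℝ} {A : Type u}
    [NonUnitalCStarAlgebra A] {g : Fin n → A} (hA : IsUniversalFor R ε A g)
    (S : NonUnitalStarSubalgebra ℂ A) (hS : IsClosed (S : Set A)) (hg : ∀ i, g i ∈ S) (x : A) :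
    x ∈ S := by
  have := hS
  let _ : NonUnitalCStarAlgebra S := NonUnitalStarSubalgebra.nonUnitalCStarAlgebra S
  let ι : S →⋆ₙₐ[ℂ] A := NonUnitalStarSubalgebraClass.subtype S
  let g' : Fin n → S := fun i => ⟨g i, hg i⟩
  have hg' : IsRepUpTo R ε g' :=
    (isRepUpTo_map_iff_of_injective ι Subtype.val_injective g').1 hA.1
  obtain ⟨π, hπ, -⟩ := hA.2 S g' hg'
  obtain ⟨_, -, huniq⟩ := hA.2 A g hA.1
  -- Both endomorphisms fix the generators, so uniqueness makes every `x` equal to `ι (π x)`, an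
  -- element of `S`.
  have h : ι.comp π = NonUnitalStarAlgHom.id ℂ A :=
    (huniq _ fun i => by
      change ι (π (g i)) = g i
      rw [hπ]
      rfl).trans
      (huniq _ fun i => rfl).symm
  have hx : ι (π x) = x := DFunLike.congr_fun h x
  rw [← hx]
  exact (π x).2

theorem Subsemigroup.countable_closure {M : Type*} [Semigroup M] {s : Set M} (hs : s.Countable) :
    (Subsemigroup.closure s : Set M).Countable := by
  have := hs.to_subtype
  have : Countable (FreeSemigroup s) :=
    Function.Injective.countable (f := fun w : FreeSemigroup s => (w.head, w.tail))
      fun v w h => FreeSemigroup.ext (congrArg Prod.fst h) (congrArg Prod.snd h)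
  let f : FreeSemigroup s →ₙ* M := FreeSemigroup.lift Subtype.val
  refine (Set.countable_range f).mono ?_
  have : Subsemigroup.closure s ≤ f.srange := Subsemigroup.closure_le.2 fun x hx =>
    ⟨FreeSemigroup.of ⟨x, hx⟩, FreeSemigroup.lift_of _ _⟩
  exact this

theorem isSeparable_topologicalClosure_adjoin {A : Type*} [NonUnitalCStarAlgebra A] {s : Set A}
    (hs : s.Countable) : TopologicalSpace.IsSeparable
      ((NonUnitalStarAlgebra.adjoin ℂ s).topologicalClosure : Set A) := by
  have h : ((NonUnitalStarAlgebra.adjoin ℂ s : NonUnitalStarSubalgebra ℂ A) : Set A) =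
      Submodule.span ℂ (Subsemigroup.closure (s ∪ star s) : Set A) :=
    congrArg (fun p : Submodule ℂ A => (p : Set A)) (NonUnitalStarAlgebra.adjoin_eq_span s)
  have hs' : (star s).Countable := by
    rw [← Set.image_star]
    exact hs.image _
  have := (TopologicalSpace.IsSeparable.span (R := ℂ)
    (Subsemigroup.countable_closure (hs.union hs')).isSeparable)
  rw [← h] at this
  exact this.closure

theorem IsUniversalFor.separableSpace {n : ℕ} {R : Set (CStarRel n)} {ε : ℝ} {A : Type u}
    [NonUnitalCStarAlgebra A] {g : Fin n → A} (hA : IsUniversalFor R ε A g) :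
    TopologicalSpace.SeparableSpace A := by
  refine TopologicalSpace.isSeparable_univ_iff.1
    ((isSeparable_topologicalClosure_adjoin (Set.countable_range g)).mono fun x _ => ?_)
  exact hA.mem_of_isClosed _ (NonUnitalStarSubalgebra.isClosed_topologicalClosure _)
    (fun i => NonUnitalStarSubalgebra.le_topologicalClosure _
      (NonUnitalStarAlgebra.subset_adjoin ℂ _ (Set.mem_range_self i))) x

/-- Homomorphisms that converge on the generators converge pointwise. -/
theorem IsUniversalFor.tendsto_apply {n : ℕ} {R : Set (CStarRel n)} {ε : ℝ} {A : Type u}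
    [NonUnitalCStarAlgebra A] {g : Fin n → A} (hA : IsUniversalFor R ε A g) {ι : Type*}
    {l : Filter ι} {B : Type*} [NonUnitalCStarAlgebra B] {χ : ι → A →⋆ₙₐ[ℂ] B}
    {θ : A →⋆ₙₐ[ℂ] B} (h : ∀ i, Tendsto (fun k => χ k (g i)) l (𝓝 (θ (g i)))) (x : A) :
    Tendsto (fun k => χ k x) l (𝓝 (θ x)) :=
  hA.mem_of_isClosed
    { carrier := {x | Tendsto (fun k => χ k x) l (𝓝 (θ x))}
      add_mem' := fun {a b} ha hb => by simpa using Tendsto.add ha hb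
      zero_mem' := by simp [tendsto_const_nhds]
      mul_mem' := fun {a b} ha hb => by simpa using Tendsto.mul ha hb
      smul_mem' := fun c {a} ha => by simpa using Tendsto.const_smul ha c
      star_mem' := fun {a} ha => by simpa [map_star] using Tendsto.star ha }
    ((equicontinuous_nonUnitalStarAlgHom χ).isClosed_setOfPred_tendsto (continuous_nonUnitalStarAlgHom θ)) h x

theorem IsUniversalFor.exists_forall_norm_sub_le {n : ℕ} {R : Set (CStarRel n)} {ε₀ : ℝ}
    {A : Type u} [NonUnitalCStarAlgebra A] {g : Fin n → A} (hA : IsUniversalFor R ε₀ A g)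
    {B : Type*} [NonUnitalCStarAlgebra B] (θ : A →⋆ₙₐ[ℂ] B) {F : Set A} (hF : F.Finite)
    {ε : ℝ} (hε : 0 < ε) : ∃ δ > 0, ∀ χ : A →⋆ₙₐ[ℂ] B, (∀ i, ‖χ (g i) - θ (g i)‖ < δ) →
      ∀ x ∈ F, ‖χ x - θ x‖ ≤ ε := by
  -- Along the filter pulled back from neighbourhoods of `θ ∘ g`, convergence on generators is
  -- tautological; its basis of balls yields `δ`.
  let l : Filter (A →⋆ₙₐ[ℂ] B) := comap (fun χ i => χ (g i)) (𝓝 fun i => θ (g i))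
  have hl (x : A) : Tendsto (fun χ : A →⋆ₙₐ[ℂ] B => χ x) l (𝓝 (θ x)) :=
    hA.tendsto_apply (χ := id) (fun i => ((continuous_apply i).tendsto _).comp tendsto_comap) x
  have h : ∀ᶠ χ in l, ∀ x ∈ F, ‖χ x - θ x‖ ≤ ε := (hF.eventually_all).2 fun x _ => by
    filter_upwards [(hl x).eventually (Metric.ball_mem_nhds _ hε)] with χ hχ
    exact (mem_ball_iff_norm.1 hχ).le
  obtain ⟨δ, hδ, H⟩ := ((Metric.nhds_basis_ball.comap _).eventually_iff).1 h
  exact ⟨δ, hδ, fun χ hχ => H ((dist_pi_lt_iff hδ).2 fun i => by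
    simpa [dist_eq_norm] using hχ i)⟩

/-! ### Approximate lifting through inductive limits -/

section InductiveLimit

variable {A : ℕ → Type u} [∀ n, NonUnitalCStarAlgebra (A n)]
  {φ : ∀ n, A n →⋆ₙₐ[ℂ] A (n + 1)} {B : Type u} [NonUnitalCStarAlgebra B]
  {ψ : ∀ n, A n →⋆ₙₐ[ℂ] B}

theorem IsInductiveLimit.map_connectingMap (h : IsInductiveLimit φ B ψ) (n k : ℕ) (x : A n) :
    ψ (n + k) (connectingMap φ n k x) = ψ n x := by
  induction k with
  | zero => rfl
  | succ k ih => exact (h.compatible (n + k) _).trans ih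

theorem IsInductiveLimit.eventually_exists_norm_sub_le (h : IsInductiveLimit φ B ψ) (y : B)
    {ε : ℝ} (hε : 0 < ε) : ∀ᶠ n in atTop, ∃ z : A n, ‖ψ n z - y‖ ≤ ε := by
  obtain ⟨b, hb, hyb⟩ := Metric.dense_iff.1 h.dense y ε hε
  obtain ⟨n, z, rfl⟩ := Set.mem_iUnion.1 hyb
  filter_upwards [eventually_ge_atTop n] with m hm
  obtain ⟨k, rfl⟩ := Nat.exists_eq_add_of_le hm
  refine ⟨connectingMap φ n k z, ?_⟩
  rw [h.map_connectingMap]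
  exact (mem_ball_iff_norm.1 hb).le

theorem IsInductiveLimit.isSeparable (h : IsInductiveLimit φ B ψ)
    (hA : ∀ n, TopologicalSpace.SeparableSpace (A n)) : TopologicalSpace.SeparableSpace B := by
  refine TopologicalSpace.isSeparable_univ_iff.1 ?_
  rw [← h.dense.closure_eq]
  exact (TopologicalSpace.IsSeparable.iUnion fun n =>
    TopologicalSpace.isSeparable_range (continuous_nonUnitalStarAlgHom (ψ n))).closure

/-- Algebras with a stable presentation are approximately projective with respect to sequential
inductive limits. -/
theorem HasStablePresentation.exists_approximate_lift {C : Type u} [NonUnitalCStarAlgebra C]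
    (hC : HasStablePresentation C) (h : IsInductiveLimit φ B ψ) (θ : C →⋆ₙₐ[ℂ] B) {F : Set C}
    (hF : F.Finite) {H : Set B} (hH : H.Finite) {ε : ℝ} (hε : 0 < ε) :
    ∃ (m : ℕ) (χ : C →⋆ₙₐ[ℂ] A m), (∀ x ∈ F, ‖ψ m (χ x) - θ x‖ ≤ ε) ∧
      (∀ x ∈ F, ‖χ x‖ ≤ ‖θ x‖ + ε) ∧ ∀ y ∈ H, ∃ z, ‖ψ m z - y‖ ≤ ε := by
  obtain ⟨N, R, g, hR, hg, hstable⟩ := hC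
  obtain ⟨δ, hδ, hχ⟩ := hg.exists_forall_norm_sub_le θ hF (half_pos hε)
  obtain ⟨η, hη, E, _, e, he, σ, hσ⟩ := hstable (δ / 2) (half_pos hδ)
  -- The slack `η` turns the closed relations into strict inequalities at `θ ∘ g`, hence into an
  -- open condition.
  have hrel : ∀ᶠ b in 𝓝 fun i => θ (g i), ∀ r ∈ R, ‖r.expr.eval b‖ < r.bound + η := by
    refine hR.eventually_all.2 fun r hr => ?_
    refine r.expr.continuous_eval.norm.continuousAt.eventually (gt_mem_nhds ?_)
    exact (hg.1.map θ r hr).trans_lt (by linarith)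
  obtain ⟨η', hη', hball⟩ := Metric.eventually_nhds_iff_ball.1 hrel
  -- With the error `δ / 2` of `σ`, the bound `δ / 4` keeps the total strictly below `δ`.
  have hgen : ∀ᶠ n in atTop, ∀ i, ∃ z : A n, ‖ψ n z - θ (g i)‖ ≤ min (δ / 4) (η' / 2) :=
    eventually_all.2 fun i => h.eventually_exists_norm_sub_le _ (by positivity)
  obtain ⟨n, hn⟩ := hgen.exists
  choose b hb using hn
  have hbrel : ∀ r ∈ R, ‖r.expr.eval fun i => ψ n (b i)‖ < r.bound + η := by
    refine hball _ ((dist_pi_lt_iff hη').2 fun i => ?_)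
    rw [dist_eq_norm]
    exact (hb i).trans_lt ((min_le_right _ _).trans_lt (half_lt_self hη'))
  -- The relations hold strictly in the limit, so they hold up to `η` at a finite stage.
  have hk : ∀ᶠ k in atTop, ∀ r ∈ R, ‖connectingMap φ n k (r.expr.eval b)‖ < r.bound + η :=
    hR.eventually_all.2 fun r hr => (h.norm_eq n _).eventually_lt_const (by
      rw [CStarExpr.map_eval]
      exact hbrel r hr)
  obtain ⟨k, hk⟩ := hk.exists
  obtain ⟨π, hπ, -⟩ := he.2 _ (fun i => connectingMap φ n k (b i)) fun r hr => by
    rw [← CStarExpr.map_eval]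
    exact (hk r hr).le
  let χ₀ : C →⋆ₙₐ[ℂ] A (n + k) := π.comp σ
  have hχ₀ : ∀ x ∈ F, ‖ψ (n + k) (χ₀ x) - θ x‖ ≤ ε / 2 := by
    refine hχ ((ψ (n + k)).comp χ₀) fun i => ?_
    have h₁ : ‖ψ (n + k) (π (σ (g i))) - ψ (n + k) (π (e i))‖ ≤ δ / 2 :=
      (norm_map_sub_map_le _ _ _).trans ((norm_map_sub_map_le _ _ _).trans (hσ i))
    rw [hπ, h.map_connectingMap] at h₁
    have h₂ := (hb i).trans (min_le_left _ _)
    have h₃ := norm_sub_le_norm_sub_add_norm_sub (ψ (n + k) (π (σ (g i)))) (ψ n (b i)) (θ (g i))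
    change ‖ψ (n + k) (π (σ (g i))) - θ (g i)‖ < δ
    linarith
  -- Moving further along shrinks `‖χ₀ x‖` towards its norm in the limit, which is close to `‖θ x‖`.
  have hl₁ : ∀ᶠ l in atTop, ∀ x ∈ F, ‖connectingMap φ (n + k) l (χ₀ x)‖ < ‖θ x‖ + ε :=
    hF.eventually_all.2 fun x hx => (h.norm_eq (n + k) _).eventually_lt_const (by
      have h₁ := hχ₀ x hx
      have h₂ := norm_sub_norm_le (ψ (n + k) (χ₀ x)) (θ x)
      linarith)
  have hl₂ : ∀ᶠ l in atTop, ∀ y ∈ H, ∃ z, ‖ψ (n + k + l) z - y‖ ≤ ε :=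
    (tendsto_add_atTop_nat (n + k)).eventually
      (p := fun m => ∀ y ∈ H, ∃ z, ‖ψ m z - y‖ ≤ ε)
      (hH.eventually_all.2 fun y _ => h.eventually_exists_norm_sub_le y hε) |>.mono fun l hl => by
        rwa [add_comm l] at hl
  obtain ⟨l, hl₁, hl₂⟩ := (hl₁.and hl₂).exists
  refine ⟨n + k + l, (connectingMap φ (n + k) l).comp χ₀, fun x hx => ?_,
    fun x hx => (hl₁ x hx).le, hl₂⟩
  change ‖ψ (n + k + l) (connectingMap φ (n + k) l (χ₀ x)) - θ x‖ ≤ ε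
  rw [h.map_connectingMap]
  linarith [hχ₀ x hx]

end InductiveLimit

/-! ### Approximate factorization -/

/-- Every homomorphism `θ : A → B` with `A` in `𝒞` factors approximately, on finite sets, through
an algebra in `𝒞` whose image in `B` is large, in such a way that the first factor almost
annihilates what `θ` annihilates. -/
def IsApproximatelyFactorized (𝒞 : CStarClass.{u}) : CStarClass.{u} := fun B _ =>
  ∀ (A : Type u) [NonUnitalCStarAlgebra A], 𝒞 A → ∀ (θ : A →⋆ₙₐ[ℂ] B) (F : Set A) (H : Set B),
    F.Finite → H.Finite → ∀ ε : ℝ, 0 < ε →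
      ∃ (A' : Type u) (_ : NonUnitalCStarAlgebra A') (α : A →⋆ₙₐ[ℂ] A') (β : A' →⋆ₙₐ[ℂ] B),
        𝒞 A' ∧ (∀ x ∈ F, ‖β (α x) - θ x‖ ≤ ε) ∧ (∀ x ∈ F, ‖α x‖ ≤ ‖θ x‖ + ε) ∧
          ∀ y ∈ H, ∃ z, ‖β z - y‖ ≤ ε

theorem isApproximatelyFactorized_of_mem {𝒞 : CStarClass.{u}} {B : Type u}
    [NonUnitalCStarAlgebra B] (hB : 𝒞 B) : IsApproximatelyFactorized 𝒞 B :=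
  fun A _ _ θ F H _ _ ε hε =>
    ⟨B, inferInstance, θ, NonUnitalStarAlgHom.id ℂ B, hB, fun x _ => by simpa using hε.le,
      fun x _ => by linarith, fun y _ => ⟨y, by simpa using hε.le⟩⟩

/-- Lift `θ` to a stage `A m`, then factorize the lift there, with `H` replaced by approximate
preimages in `A m`; each half costs `ε / 2`. -/
theorem IsInductiveLimit.isApproximatelyFactorized {A : ℕ → Type u}
    [∀ n, NonUnitalCStarAlgebra (A n)] {φ : ∀ n, A n →⋆ₙₐ[ℂ] A (n + 1)} {B : Type u}
    [NonUnitalCStarAlgebra B] {ψ : ∀ n, A n →⋆ₙₐ[ℂ] B} (h : IsInductiveLimit φ B ψ)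
    (hA : ∀ n, IsApproximatelyFactorized HasStablePresentation (A n)) :
    IsApproximatelyFactorized HasStablePresentation B := by
  intro C _ hC θ F H hF hH ε hε
  obtain ⟨m, χ, hχ, hχ', hH'⟩ := hC.exists_approximate_lift h θ hF hH (half_pos hε)
  choose! z hz using hH'
  obtain ⟨A', _, α, β, hA', hαβ, hα, hβ⟩ :=
    hA m C hC χ F (z '' H) hF (hH.image z) (ε / 2) (half_pos hε)
  refine ⟨A', inferInstance, α, (ψ m).comp β, hA', fun x hx => ?_, fun x hx => ?_, fun y hy => ?_⟩
  · have h₁ := norm_sub_le_norm_sub_add_norm_sub (ψ m (β (α x))) (ψ m (χ x)) (θ x)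
    have h₂ := (norm_map_sub_map_le (ψ m) _ _).trans (hαβ x hx)
    change ‖ψ m (β (α x)) - θ x‖ ≤ ε
    linarith [hχ x hx]
  · linarith [hα x hx, hχ' x hx]
  · obtain ⟨w, hw⟩ := hβ _ (Set.mem_image_of_mem z hy)
    refine ⟨w, ?_⟩
    have h₁ := norm_sub_le_norm_sub_add_norm_sub (ψ m (β w)) (ψ m (z y)) y
    have h₂ := (norm_map_sub_map_le (ψ m) _ _).trans hw
    change ‖ψ m (β w) - y‖ ≤ ε
    linarith [hz y hy]

/-- A pointwise Cauchy sequence of homomorphisms converges to a homomorphism. -/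
theorem exists_nonUnitalStarAlgHom_tendsto {A : Type*} {B : Type*} [NonUnitalCStarAlgebra A]
    [NonUnitalCStarAlgebra B] (f : ℕ → A →⋆ₙₐ[ℂ] B)
    (hf : ∀ x, CauchySeq fun k => f k x) :
    ∃ ψ : A →⋆ₙₐ[ℂ] B, ∀ x, Tendsto (fun k => f k x) atTop (𝓝 (ψ x)) := by
  choose ψ hψ using fun x => cauchySeq_tendsto_of_complete (hf x)
  refine ⟨{ toFun := ψ, map_smul' := fun c x => ?_, map_zero' := ?_, map_add' := fun x y => ?_,
            map_mul' := fun x y => ?_, map_star' := fun x => ?_ }, hψ⟩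
  · exact tendsto_nhds_unique (hψ (c • x)) (by simpa using (hψ x).const_smul c)
  · exact tendsto_nhds_unique (hψ 0) (by simp)
  · exact tendsto_nhds_unique (hψ (x + y)) (by simpa using (hψ x).add (hψ y))
  · exact tendsto_nhds_unique (hψ (x * y)) (by simpa using (hψ x).mul (hψ y))
  · exact tendsto_nhds_unique (hψ (star x)) (by simpa [map_star] using (hψ x).star)

theorem cauchySeq_apply_of_dense {A : Type*} {B : Type*} [NonUnitalCStarAlgebra A]
    [NonUnitalCStarAlgebra B] (f : ℕ → A →⋆ₙₐ[ℂ] B) {D : Set A} (hD : Dense D)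
    (hf : ∀ x ∈ D, CauchySeq fun k => f k x) (x : A) : CauchySeq fun k => f k x := by
  refine Metric.cauchySeq_iff'.2 fun ε hε => ?_
  obtain ⟨y, hxy, hy⟩ := Metric.dense_iff.1 hD x (ε / 3) (by positivity)
  obtain ⟨N, hN⟩ := Metric.cauchySeq_iff'.1 (hf y hy) (ε / 3) (by positivity)
  refine ⟨N, fun k hk => ?_⟩
  have h (j : ℕ) : dist (f j y) (f j x) < ε / 3 := by
    rw [dist_eq_norm]
    exact (norm_map_sub_map_le _ _ _).trans_lt (mem_ball_iff_norm.1 hxy)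
  have h₁ := dist_triangle4 (f k x) (f k y) (f N y) (f N x)
  have h₂ := h k
  rw [dist_comm] at h₂
  linarith [h N, hN k hk]

theorem tendsto_norm_apply_of_dense {A : Type*} {B : ℕ → Type*} {C : Type*}
    [NonUnitalCStarAlgebra A] [∀ k, NonUnitalCStarAlgebra (B k)] [NonUnitalCStarAlgebra C]
    (f : ∀ k, A →⋆ₙₐ[ℂ] B k) (ψ : A →⋆ₙₐ[ℂ] C) {D : Set A} (hD : Dense D)
    (hf : ∀ x ∈ D, Tendsto (fun k => ‖f k x‖) atTop (𝓝 ‖ψ x‖)) (x : A) :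
    Tendsto (fun k => ‖f k x‖) atTop (𝓝 ‖ψ x‖) := by
  have hequi : Equicontinuous fun k x => ‖f k x‖ :=
    (LipschitzWith.uniformEquicontinuous _ 1 fun k => LipschitzWith.of_dist_le_mul fun x y => by
      rw [NNReal.coe_one, one_mul, dist_eq_norm, dist_eq_norm]
      exact (abs_norm_sub_norm_le _ _).trans (norm_map_sub_map_le (f k) x y)).equicontinuous
  have hclosed := hequi.isClosed_setOfPred_tendsto (l := atTop)
    (continuous_nonUnitalStarAlgHom ψ).norm
  exact hclosed.closure_subset_iff.2 hf (hD x)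

/-! ### Approximate intertwining -/

section ApproximateIntertwining

variable {A : ℕ → Type u} [∀ n, NonUnitalCStarAlgebra (A n)]
  {φ : ∀ n, A n →⋆ₙₐ[ℂ] A (n + 1)}

/-- The sigma type avoids a transport between `A (n + 1 + k)` and `A (n + (k + 1))`. -/
theorem connectingMap_succ_map (n k : ℕ) (x : A n) :
    (⟨n + 1 + k, connectingMap φ (n + 1) k (φ n x)⟩ : Σ m, A m) =
      ⟨n + (k + 1), connectingMap φ n (k + 1) x⟩ := by
  induction k with
  | zero => rfl
  | succ k ih => exact congrArg (fun s : Σ m, A m => (⟨s.1 + 1, φ s.1 s.2⟩ : Σ m, A m)) ih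

theorem connectingMap_mem {P : ∀ n, ℕ → Set (A n)}
    (hP : ∀ n j, ∀ x ∈ P n j, φ n x ∈ P (n + 1) j) {n j : ℕ} {x : A n} (hx : x ∈ P n j) (k : ℕ) :
    connectingMap φ n k x ∈ P (n + k) j := by
  induction k with
  | zero => exact hx
  | succ k ih => exact hP _ _ _ ih

/-- The limit maps are `ψ n = lim_k θ (n + k) ∘ φ_{n, n+k}`. An element of `P n j` lies in the
controlled set from stage `j` on, where the errors are summable. -/
theorem exists_isInductiveLimit_of_approximate_intertwining {B : Type u}
    [NonUnitalCStarAlgebra B] (θ : ∀ n, A n →⋆ₙₐ[ℂ] B) (P : ∀ n, ℕ → Set (A n))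
    (hmono : ∀ n, Monotone (P n)) (hdense : ∀ n, Dense (⋃ j, P n j))
    (hP : ∀ n j, ∀ x ∈ P n j, φ n x ∈ P (n + 1) j)
    (hθ : ∀ n, ∀ x ∈ P n n, ‖θ (n + 1) (φ n x) - θ n x‖ ≤ (1 / 2 : ℝ) ^ n)
    (hφ : ∀ n, ∀ x ∈ P n n, ‖φ n x‖ ≤ ‖θ n x‖ + (1 / 2 : ℝ) ^ n)
    {H : Set B} (hH : Dense H)
    (hsurj : ∀ y ∈ H, ∀ᶠ n in atTop, ∃ z ∈ P n n, ‖θ n z - y‖ ≤ 2 * (1 / 2 : ℝ) ^ n) :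
    ∃ ψ : ∀ n, A n →⋆ₙₐ[ℂ] B, IsInductiveLimit φ B ψ := by
  let u (n k : ℕ) : A n →⋆ₙₐ[ℂ] B := (θ (n + k)).comp (connectingMap φ n k)
  have hmem {n j : ℕ} {x : A n} (hx : x ∈ P n j) {k : ℕ} (hk : j ≤ n + k) :
      connectingMap φ n k x ∈ P (n + k) (n + k) :=
    hmono _ hk (connectingMap_mem hP hx k)
  have hstep {n j : ℕ} {x : A n} (hx : x ∈ P n j) {k : ℕ} (hk : j ≤ n + k) :
      dist (u n k x) (u n (k + 1) x) ≤ (1 / 2 : ℝ) ^ (n + k) := by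
    rw [dist_comm, dist_eq_norm]
    exact hθ _ _ (hmem hx hk)
  have hcauchy (n : ℕ) (x : A n) : CauchySeq fun k => u n k x := by
    refine cauchySeq_apply_of_dense (u n) (hdense n) (fun x hx => ?_) x
    obtain ⟨j, hx⟩ := Set.mem_iUnion.1 hx
    refine (cauchySeq_shift j).1 (cauchySeq_of_le_geometric (1 / 2) 1 (by norm_num) fun k => ?_)
    rw [one_mul, Nat.add_right_comm]
    exact (hstep hx (by omega)).trans
      (pow_le_pow_of_le_one (by norm_num) (by norm_num) (by omega))
  choose ψ hψ using fun n => exists_nonUnitalStarAlgHom_tendsto (u n) (hcauchy n)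
  have hdist {n : ℕ} {x : A n} (hx : x ∈ P n n) : dist (θ n x) (ψ n x) ≤ 2 * (1 / 2 : ℝ) ^ n := by
    have h := dist_le_of_le_geometric_of_tendsto₀ (1 / 2) ((1 / 2 : ℝ) ^ n) (by norm_num)
      (fun k => (hstep hx (Nat.le_add_right n k)).trans_eq (pow_add _ n k)) (hψ n x)
    exact h.trans_eq (by ring)
  refine ⟨ψ, fun n x => ?_, ?_, fun n x => ?_⟩
  · refine tendsto_nhds_unique (hψ (n + 1) (φ n x)) ?_
    refine ((hψ n x).comp (tendsto_add_atTop_nat 1)).congr fun k => ?_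
    exact (congrArg (fun s : Σ m, A m => θ s.1 s.2) (connectingMap_succ_map n k x)).symm
  · refine dense_iff_closure_eq.2 (Set.eq_univ_of_univ_subset ?_)
    rw [← hH.closure_eq]
    refine closure_minimal (fun y hy => Metric.mem_closure_iff.2 fun ε hε => ?_) isClosed_closure
    -- The 4 is 2 from `hsurj` plus 2 from `hdist`.
    have hlim : Tendsto (fun n : ℕ => 4 * (1 / 2 : ℝ) ^ n) atTop (𝓝 0) := by
      simpa using (tendsto_pow_atTop_nhds_zero_of_lt_one (r := (1 / 2 : ℝ)) (by norm_num)
        (by norm_num)).const_mul 4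
    obtain ⟨n, ⟨z, hz, hzy⟩, hn⟩ := ((hsurj y hy).and (hlim.eventually_lt_const hε)).exists
    refine ⟨ψ n z, Set.mem_iUnion.2 ⟨n, z, rfl⟩, ?_⟩
    have h₁ := dist_triangle y (θ n z) (ψ n z)
    have h₂ := hdist hz
    rw [← dist_eq_norm, dist_comm] at hzy
    linarith
  · refine tendsto_norm_apply_of_dense (fun k => connectingMap φ n k) (ψ n) (hdense n)
      (fun x hx => ?_) x
    obtain ⟨j, hx⟩ := Set.mem_iUnion.1 hx
    have hlim : Tendsto (fun k : ℕ => ‖u n k x‖ + (1 / 2 : ℝ) ^ (n + k)) atTop (𝓝 ‖ψ n x‖) := by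
      have h₁ := (tendsto_pow_atTop_nhds_zero_of_lt_one (r := (1 / 2 : ℝ)) (by norm_num)
        (by norm_num)).comp (tendsto_add_atTop_nat n)
      simpa [Function.comp_def, add_comm] using (hψ n x).norm.add h₁
    -- `hφ` compares stage `k + 1` with `θ` at stage `k`, so the squeeze is run on the shifted
    -- sequence.
    refine (tendsto_add_atTop_iff_nat 1).1 ?_
    refine tendsto_of_tendsto_of_tendsto_of_le_of_le'
      ((hψ n x).norm.comp (tendsto_add_atTop_nat 1)) hlim
      (Eventually.of_forall fun k => NonUnitalStarAlgHom.norm_apply_le (θ (n + (k + 1))) _) ?_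
    filter_upwards [eventually_ge_atTop j] with k hk
    exact hφ _ _ (hmem hx (by omega))

end ApproximateIntertwining

/-! ### Building the sequence -/

/-- A homomorphism into `B` from an algebra in `𝒞`, together with an increasing sequence of finite
subsets of its domain whose union is dense. -/
structure FiltrationOver (𝒞 : CStarClass.{u}) (B : Type u) [NonUnitalCStarAlgebra B] where
  carrier : Type u
  [inst : NonUnitalCStarAlgebra carrier]
  mem : 𝒞 carrier
  map : carrier →⋆ₙₐ[ℂ] B
  level : ℕ → Set carrier
  finite : ∀ j, (level j).Finite
  mono : Monotone level
  dense : Dense (⋃ j, level j)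

attribute [instance] FiltrationOver.inst

theorem exists_finite_monotone_dense (X : Type*) [TopologicalSpace X]
    [TopologicalSpace.SeparableSpace X] :
    ∃ P : ℕ → Set X, (∀ j, (P j).Finite) ∧ Monotone P ∧ Dense (⋃ j, P j) := by
  obtain ⟨s, hs, hd⟩ := TopologicalSpace.exists_countable_dense X
  have := hs.to_subtype
  obtain ⟨e, he⟩ := exists_injective_nat s
  refine ⟨fun j => Subtype.val '' {x : s | e x ≤ j}, fun j => ?_, fun i j hij => ?_, ?_⟩
  · exact (Set.Finite.preimage he.injOn (Set.finite_Iic j)).image _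
  · exact Set.image_mono fun x hx => le_trans hx hij
  · exact hd.mono fun x hx => Set.mem_iUnion.2 ⟨e ⟨x, hx⟩, ⟨x, hx⟩, le_refl (e _), rfl⟩

theorem IsApproximatelyFactorized.exists_next {𝒞 : CStarClass.{u}}
    (h𝒞 : ∀ (A : Type u) [NonUnitalCStarAlgebra A], 𝒞 A → TopologicalSpace.SeparableSpace A)
    {B : Type u} [NonUnitalCStarAlgebra B] (hB : IsApproximatelyFactorized 𝒞 B)
    (S : FiltrationOver 𝒞 B) (j : ℕ) {H : Set B} (hH : H.Finite) {ε : ℝ} (hε : 0 < ε) :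
    ∃ (T : FiltrationOver 𝒞 B) (α : S.carrier →⋆ₙₐ[ℂ] T.carrier),
      (∀ i, ∀ x ∈ S.level i, α x ∈ T.level i) ∧
      (∀ x ∈ S.level j, ‖T.map (α x) - S.map x‖ ≤ ε) ∧
      (∀ x ∈ S.level j, ‖α x‖ ≤ ‖S.map x‖ + ε) ∧
      ∀ y ∈ H, ∃ z ∈ T.level 0, ‖T.map z - y‖ ≤ ε := by
  obtain ⟨A, _, α, β, hA, hβα, hα, hβ⟩ := hB S.carrier S.mem S.map (S.level j) H (S.finite j) hH
    ε hε
  choose! z hz using hβ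
  have := h𝒞 A hA
  obtain ⟨P, hP, hPmono, hPdense⟩ := exists_finite_monotone_dense A
  -- Adjoining `α '' S.level i` makes the levels compatible with `α`; adjoining `z '' H` at every
  -- level makes it available already at level 0.
  refine ⟨⟨A, hA, β, fun i => P i ∪ (α '' S.level i ∪ z '' H),
    fun i => (hP i).union (((S.finite i).image _).union (hH.image _)),
    fun i k hik => Set.union_subset_union (hPmono hik)
      (Set.union_subset_union_left _ (Set.image_mono (S.mono hik))),
    hPdense.mono (Set.iUnion_mono fun i => Set.subset_union_left)⟩, α,
    fun i x hx => Or.inr (Or.inl ⟨x, hx, rfl⟩), hβα, hα,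
    fun y hy => ⟨z y, Or.inr (Or.inr ⟨y, hy, rfl⟩), hz y hy⟩⟩

theorem IsApproximatelyFactorized.sequentialLimits {𝒞 : CStarClass.{u}}
    (h𝒞 : ∀ (A : Type u) [NonUnitalCStarAlgebra A], 𝒞 A → TopologicalSpace.SeparableSpace A)
    {B : Type u} [NonUnitalCStarAlgebra B] [TopologicalSpace.SeparableSpace B]
    (hB : IsApproximatelyFactorized 𝒞 B)
    (hne : ∃ (A : Type u) (_ : NonUnitalCStarAlgebra A), 𝒞 A ∧ Nonempty (A →⋆ₙₐ[ℂ] B)) :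
    SequentialLimits 𝒞 B := by
  obtain ⟨H, hH, hHmono, hHdense⟩ := exists_finite_monotone_dense B
  obtain ⟨A₀, _, hA₀, ⟨θ₀⟩⟩ := hne
  have := h𝒞 A₀ hA₀
  obtain ⟨P, hP, hPmono, hPdense⟩ := exists_finite_monotone_dense A₀
  let S₀ : FiltrationOver 𝒞 B := ⟨A₀, hA₀, θ₀, P, hP, hPmono, hPdense⟩
  choose next hnext using fun (n : ℕ) (S : FiltrationOver 𝒞 B) =>
    hB.exists_next h𝒞 S n (hH n) (ε := (1 / 2 : ℝ) ^ n) (by positivity)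
  obtain ⟨S, hS⟩ : ∃ S : ℕ → FiltrationOver 𝒞 B, ∀ n, S (n + 1) = next n (S n) :=
    ⟨fun n => Nat.rec S₀ next n, fun _ => rfl⟩
  choose φ hφ hθ hnorm hsurj using fun n => hS n ▸ hnext n (S n)
  obtain ⟨ψ, hψ⟩ := exists_isInductiveLimit_of_approximate_intertwining (φ := φ)
    (fun n => (S n).map) (fun n => (S n).level) (fun n => (S n).mono) (fun n => (S n).dense)
    hφ hθ hnorm hHdense fun y hy => by
      obtain ⟨j, hj⟩ := Set.mem_iUnion.1 hy
      filter_upwards [eventually_ge_atTop (j + 1)] with n hn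
      obtain ⟨m, rfl⟩ : ∃ m, n = m + 1 := ⟨n - 1, by omega⟩
      obtain ⟨z, hz, hzy⟩ := hsurj m y (hHmono (by omega) hj)
      refine ⟨z, (S (m + 1)).mono (Nat.zero_le _) hz, hzy.trans (le_of_eq ?_)⟩
      -- Elements of `H m` are approximated at stage `m + 1` within `(1 / 2) ^ m`, whence the factor
      -- 2.
      ring
  exact ⟨fun n => (S n).carrier, inferInstance, φ, ψ, fun n => (S n).mem, hψ⟩

theorem theorem11p0p6 (B : Type u) [NonUnitalCStarAlgebra B] :
    SequentialLimits.{u} HasStablePresentation.{u} B ↔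
      LimitClosure.{u} HasStablePresentation.{u} B := by
  have hsep (A : Type u) [NonUnitalCStarAlgebra A] (hA : HasStablePresentation A) :
      TopologicalSpace.SeparableSpace A := by
    obtain ⟨n, R, g, -, hg, -⟩ := hA
    exact hg.separableSpace
  refine ⟨fun hB 𝒟 h𝒟 hlim => ?_, fun hB => ?_⟩
  · obtain ⟨A, _, φ, ψ, hA, h⟩ := hB
    exact hlim B ⟨A, _, φ, ψ, fun n => h𝒟 _ (hA n), h⟩
  -- Minimality of the closure is applied to a conjunction; its third clause only supplies an
  -- algebra with which the recursion can start.
  · obtain ⟨hBsep, hBfac, hBne⟩ := hB (fun A _ => TopologicalSpace.SeparableSpace A ∧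
        IsApproximatelyFactorized HasStablePresentation A ∧
        ∃ (C : Type u) (_ : NonUnitalCStarAlgebra C),
          HasStablePresentation C ∧ Nonempty (C →⋆ₙₐ[ℂ] A))
      (fun A _ hA => ⟨hsep A hA, isApproximatelyFactorized_of_mem hA,
        A, _, hA, ⟨NonUnitalStarAlgHom.id ℂ A⟩⟩)
      (by
        rintro L _ ⟨A, _, φ, ψ, hA, h⟩
        obtain ⟨C, _, hC, ⟨θ⟩⟩ := (hA 0).2.2
        exact ⟨h.isSeparable fun n => (hA n).1, h.isApproximatelyFactorized fun n => (hA n).2.1,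
          C, _, hC, ⟨(ψ 0).comp θ⟩⟩)
    exact hBfac.sequentialLimits hsep hBne
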